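/- Let $d\ge 1$ and let $f$ be a real-valued function that is (real-)analytic in an open subset of $\mathbb R^d$ containing $[0,1]^d$. Then there is a constant $c>0$, depending only on $f$, with the following property. Let $\omega:[0,1]^d\to[0,\infty)$ be an integrable weight function, and put $I[g]=\int_{[0,1]^d} g(x)\,\omega(x)\,dx$. Let $(C_N)_{N\in\mathbb N}$ be a sequence of cubature formulas $C_N[g]=\sum_{n=1}^N w_n^{(N)} g(x_n^{(N)})$ and let $m=m(N)$ be a sequence of nonnegative integers such that, for all sufficiently large $N$, the points $x_n^{(N)}$ lie in $[0,1]^d$, the weights $w_n^{(N)}$ are positive, and $C_N[p]=I[p]$ for every polynomial $p$ in $d$ real variables of total degree at most $m(N)$. Then $$|I[f]-C_N[f]|=\mathcal O\!\left(\exp\!\left(-c\,m(N)/\sqrt d\right)\right)\qquad (N\to\infty).$$ Moreover, the constant depends on $f$ only through the location of its singularities, and not on $d$: for $\rho>1$ let $E_\rho=\{z\in\mathbb C: |z|+|z-1|<\tfrac12(\rho+\rho^{-1})\}$ be the Bernstein ellipse of radius $\rho$ of the interval $[0,1]$. For every $\rho>1$ there is a constant $c>0$, depending only on $\rho$, such that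 the same estimate holds, with this $c$, for every $d\ge1$, every $f:[0,1]^d\to\mathbb R$ that extends to a holomorphic function on $E_\rho^d\subset\mathbb C^d$, and all $\omega$, $(C_N)$ and $m$ as above. -/

import Mathlib

open MeasureTheory Filter Asymptotics

/-- The hypercube `[0,1]^d`. -/
def unitCube (d : ℕ) : Set (Fin d → ℝ) := Set.Icc 0 1

/-- The weighted integral `I[g] = ∫_{[0,1]^d} g(x) ω(x) dx`. -/
noncomputable def weightedIntegral {d : ℕ} (ω g : (Fin d → ℝ) → ℝ) : ℝ :=
  ∫ x in unitCube d, g x * ω x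

/-- An `N`-point cubature formula on `ℝ^d`: data points `x_1, …, x_N` and weights `w_1, …, w_N`. -/
structure CubatureFormula (d N : ℕ) where
  point : Fin N → (Fin d → ℝ)
  weight : Fin N → ℝ

namespace CubatureFormula

variable {d N : ℕ}

/-- The value `C_N[g] = ∑ n, w_n g(x_n)`. -/
def apply (C : CubatureFormula d N) (g : (Fin d → ℝ) → ℝ) : ℝ :=
  ∑ n, C.weight n * g (C.point n)

/-- All data points lie in the integration domain `[0,1]^d`. -/
def IsInside (C : CubatureFormula d N) : Prop := ∀ n, C.point n ∈ unitCube d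

/-- All cubature weights are positive. -/
def IsPositive (C : CubatureFormula d N) : Prop := ∀ n, 0 < C.weight n

/-- `C[p] = I[p]` for every polynomial `p` in `d` variables of total degree at most `m`. -/
def IsExact (C : CubatureFormula d N) (ω : (Fin d → ℝ) → ℝ) (m : ℕ) : Prop :=
  ∀ p : MvPolynomial (Fin d) ℝ, p.totalDegree ≤ m →
    C.apply (fun x => MvPolynomial.eval x p) = weightedIntegral ω (fun x => MvPolynomial.eval x p)

end CubatureFormula

/-- The open Bernstein ellipse of radius `ρ` of the interval `[0,1]`: it has foci `0` and `1`, and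
it is the image of the usual ellipse `|z - 1| + |z + 1| < ρ + 1/ρ` of `[-1,1]` under
`z ↦ (z + 1) / 2`. -/
def bernsteinEllipse (ρ : ℝ) : Set ℂ := {z | ‖z‖ + ‖z - 1‖ < (ρ + ρ⁻¹) / 2}

/-- `f`, restricted to `[0,1]^d`, extends to a holomorphic function on the `d`-fold product of the
Bernstein ellipse of radius `ρ`. -/
def HasBernsteinExtension {d : ℕ} (f : (Fin d → ℝ) → ℝ) (ρ : ℝ) : Prop :=
  ∃ F : (Fin d → ℂ) → ℂ,
    DifferentiableOn ℂ F {z | ∀ j, z j ∈ bernsteinEllipse ρ} ∧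
    ∀ x ∈ unitCube d, F (fun j => (x j : ℂ)) = (f x : ℂ)

/-! A positive formula that is exact on polynomials of degree at most `m` has weights summing to `∫
ω`, so its error on `f` is at most `2 ∫ ω` times the uniform distance from `f` to those polynomials.
It therefore suffices to approximate `f` exponentially well in the total degree.

The substitution `x_j = (1 + cos 2πθ_j) / 2` makes `f` a periodic function on the torus, even in
each variable. Its Fourier series is thus a series in products of shifted Chebyshev polynomials,
whose total degree is the `ℓ¹` norm of the frequency `k`. If the coefficients decay like `exp (-a
|k|₁)`, truncation at `|k|₁ ≤ m` gives the approximation.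

That decay is obtained along lines: if `v` is the sign vector of `k`, then `k · v = |k|₁`, so
averaging over translations in direction `v` reduces the coefficient at `k` to one-dimensional
coefficients of frequency `|k|₁` (`norm_mFourierCoeff_le`). These decay exponentially once the
derivatives along `v` satisfy Cauchy estimates (`norm_integral_exp_mul_le`). For real analytic `f`
the estimates come from compactness; for `f` holomorphic on `E_ρ^d` they come from Cauchy's
inequality in a strip whose width depends only on `ρ`, since all coordinates move together. Hence
the rate is independent of `d`. -/

/-! ### Fourier coefficients in one variable -/

/-- Repeated integration by parts: the `n`-th Fourier coefficient of a periodic smooth function, times `(2πin)^l`, is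
the `n`-th Fourier coefficient of its `l`-th derivative. -/
theorem pow_mul_integral_exp_mul_eq {h : ℕ → ℝ → ℂ}
    (hd : ∀ l t, HasDerivAt (h l) (h (l + 1) t) t) (hper : ∀ l, h l 1 = h l 0) (n l : ℕ) :
    (2 * Real.pi * Complex.I * n) ^ l *
        ∫ t in (0 : ℝ)..1, Complex.exp (-(2 * Real.pi * Complex.I * n) * t) * h 0 t =
      ∫ t in (0 : ℝ)..1, Complex.exp (-(2 * Real.pi * Complex.I * n) * t) * h l t := by
  induction l with
  | zero => simp
  | succ l ih =>
    set a : ℂ := 2 * Real.pi * Complex.I * n with ha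
    have hcont (l : ℕ) : Continuous (h l) :=
      continuous_iff_continuousAt.2 fun t => (hd l t).continuousAt
    have he (t : ℝ) : HasDerivAt (fun t : ℝ => Complex.exp (-a * t))
        (-a * Complex.exp (-a * t)) t := by
      have h1 : HasDerivAt (fun t : ℝ => -a * (t : ℂ)) (-a * 1) t :=
        (Complex.ofRealCLM.hasDerivAt (x := t)).const_mul (-a)
      simpa [mul_comm] using h1.cexp
    have hone : Complex.exp (-a * (1 : ℝ)) = 1 := by
      rw [Complex.exp_eq_one_iff]
      exact ⟨-n, by rw [ha]; push_cast; ring⟩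
    have key := intervalIntegral.integral_mul_deriv_eq_deriv_mul (a := 0) (b := 1)
      (fun t _ => he t) (fun t _ => hd l t)
      ((by fun_prop : Continuous fun t : ℝ => -a * Complex.exp (-a * t)).intervalIntegrable _ _)
      ((hcont (l + 1)).intervalIntegrable _ _)
    rw [key, hone, hper l, pow_succ', mul_assoc, ih]
    simp [mul_assoc]

/-- The Fourier coefficients of a periodic function whose derivatives satisfy Cauchy type estimates decay
exponentially. -/
theorem norm_integral_exp_mul_le {h : ℕ → ℝ → ℂ}
    (hd : ∀ l t, HasDerivAt (h l) (h (l + 1) t) t) (hper : ∀ l, h l 1 = h l 0)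
    {B R : ℝ} (hR : 0 < R)
    (hb : ∀ l, ∀ t ∈ Set.Icc (0 : ℝ) 1, ‖h l t‖ ≤ B * l.factorial * R ^ l) (n : ℕ) :
    ‖∫ t in (0 : ℝ)..1, Complex.exp (-(2 * Real.pi * Complex.I * n) * t) * h 0 t‖ ≤
      2 * B * Real.exp (-(Real.pi / R * n)) := by
  set I := ∫ t in (0 : ℝ)..1, Complex.exp (-(2 * Real.pi * Complex.I * n) * t) * h 0 t with hI
  have hl (l : ℕ) : (2 * Real.pi * n) ^ l * ‖I‖ ≤ B * l.factorial * R ^ l := by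
    have h1 : ‖∫ t in (0 : ℝ)..1, Complex.exp (-(2 * Real.pi * Complex.I * n) * t) * h l t‖ ≤
        (B * l.factorial * R ^ l) * |(1 : ℝ) - 0| := by
      refine intervalIntegral.norm_integral_le_of_norm_le_const fun t ht => ?_
      rw [Set.uIoc_of_le zero_le_one] at ht
      rw [norm_mul, Complex.norm_exp]
      simpa using hb l t ⟨ht.1.le, ht.2⟩
    rw [← pow_mul_integral_exp_mul_eq hd hper n l, norm_mul, norm_pow] at h1
    have hn : ‖(2 * Real.pi * Complex.I * n : ℂ)‖ = 2 * Real.pi * n := by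
      simp [abs_of_pos Real.pi_pos]
    rwa [hn, sub_zero, abs_one, mul_one] at h1
  -- Instead of optimizing over `l`, the bounds for all `l` are summed into an exponential series.
  -- Using `π / R`, half of the critical `2π / R`, leaves the geometric factor `(1 / 2) ^ l`, whose
  -- sum is the 2 in the statement.
  have hterm (l : ℕ) : (Real.pi / R * n) ^ l / l.factorial * ‖I‖ ≤ B * (1 / 2) ^ l := by
    have hf : (0 : ℝ) < l.factorial := by positivity
    have h2 : (Real.pi / R * n) ^ l = (2 * Real.pi * n) ^ l / (2 ^ l * R ^ l) := by
      rw [← mul_pow, ← div_pow]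
      congr 1
      field_simp
    rw [h2, div_div, div_mul_eq_mul_div, div_le_iff₀ (by positivity), one_div, inv_pow]
    calc _ ≤ _ := hl l
      _ = _ := by field_simp
  have hexp : HasSum (fun l : ℕ => (Real.pi / R * n) ^ l / l.factorial * ‖I‖)
      (Real.exp (Real.pi / R * n) * ‖I‖) := by
    have h3 := NormedSpace.expSeries_div_hasSum_exp (Real.pi / R * n : ℝ)
    rw [← Real.exp_eq_exp_ℝ] at h3
    exact h3.mul_right _
  have hgeom : HasSum (fun l : ℕ => B * (1 / 2 : ℝ) ^ l) (B * 2) :=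
    hasSum_geometric_two.mul_left B
  have := hasSum_le hterm hexp hgeom
  rw [Real.exp_neg, ← div_eq_mul_inv, le_div_iff₀ (Real.exp_pos _)]
  linarith

/-! ### Fourier series on the torus -/

/-- The partial Fourier coefficients along signed diagonal directions control the Fourier coefficients on the torus. -/
theorem norm_mFourierCoeff_le {d : ℕ} {g : UnitAddTorus (Fin d) → ℂ} (hg : Continuous g) {a B : ℝ}
    (hb : ∀ y : Fin d → ℝ, (∀ i, y i ∈ Set.Ioc (0 : ℝ) 1) → ∀ v : Fin d → ℝ,
      (∀ i, v i = 1 ∨ v i = -1) → ∀ n : ℕ,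
        ‖∫ t in (0 : ℝ)..1, Complex.exp (-(2 * Real.pi * Complex.I * n) * t) *
          g (fun i => ((y i + t * v i : ℝ) : UnitAddCircle))‖ ≤ B * Real.exp (-(a * n)))
    (k : Fin d → ℤ) :
    ‖UnitAddTorus.mFourierCoeff g k‖ ≤ B * Real.exp (-(a * (∑ i, (k i).natAbs : ℕ))) := by
  set n : ℕ := ∑ i, (k i).natAbs with hn
  obtain ⟨v, hv, hvk⟩ : ∃ v : Fin d → ℝ, (∀ i, v i = 1 ∨ v i = -1) ∧
      ∀ i, (k i : ℝ) * v i = (k i).natAbs := by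
    refine ⟨fun i => if 0 ≤ k i then 1 else -1, fun i => by beta_reduce; split_ifs <;> simp,
      fun i => ?_⟩
    rw [Nat.cast_natAbs]
    beta_reduce
    split_ifs with h
    · simp [abs_of_nonneg h]
    · simp [abs_of_neg (not_le.1 h)]
  set S : Set (Fin d → ℝ) := {x | ∀ i, x i ∈ Set.Ioc (0 : ℝ) (0 + 1)} with hS
  have hSpi : S = Set.univ.pi fun _ => Set.Ioc (0 : ℝ) (0 + 1) := by ext; simp [hS]
  have hSm : MeasurableSet S := hSpi ▸ MeasurableSet.univ_pi fun _ => measurableSet_Ioc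
  have hSv : volume S = 1 := by rw [hSpi, volume_pi_pi]; simp
  have hexp (t : ℝ) (y : Fin d → ℝ) :
      UnitAddTorus.mFourier (-k) (fun i => ((y i + t * v i : ℝ) : UnitAddCircle)) =
      UnitAddTorus.mFourier (-k) (fun i => (y i : UnitAddCircle)) *
        Complex.exp (-(2 * Real.pi * Complex.I * n) * t) := by
    simp only [UnitAddTorus.mFourier, ContinuousMap.coe_mk, fourier_coe_apply, ← Complex.exp_sum,
      ← Complex.exp_add]
    congr 1
    have hnc : (n : ℂ) = ∑ i, (k i : ℂ) * (v i : ℂ) := by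
      rw [hn]; push_cast
      refine Finset.sum_congr rfl fun i _ => ?_
      have := congrArg (fun r : ℝ => (r : ℂ)) (hvk i)
      push_cast at this; exact this.symm
    rw [hnc, Finset.mul_sum, ← Finset.sum_neg_distrib, Finset.sum_mul, ← Finset.sum_add_distrib]
    refine Finset.sum_congr rfl fun i _ => ?_
    push_cast [Pi.neg_apply]; ring
  -- The integral over a period cell does not see the translation by `t • v`, so the right-hand side
  -- is the same for every `t`; it may be averaged over `t ∈ [0, 1]`.
  have hshift (t : ℝ) : UnitAddTorus.mFourierCoeff g k =
      ∫ y in S, UnitAddTorus.mFourier (-k) (fun i => (y i : UnitAddCircle)) *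
        (Complex.exp (-(2 * Real.pi * Complex.I * n) * t) *
          g (fun i => ((y i + t * v i : ℝ) : UnitAddCircle))) := by
    rw [UnitAddTorus.mFourierCoeff_eq_integral g k (fun i => t * v i)]
    have hmp := measurePreserving_add_right (volume : Measure (Fin d → ℝ)) (fun i => t * v i)
    rw [← hmp.setIntegral_preimage_emb (measurableEmbedding_addRight _)]
    have hpre : (fun x : Fin d → ℝ => x + fun i => t * v i) ⁻¹'
        {x | ∀ i, x i ∈ Set.Ioc (t * v i) (t * v i + 1)} = S := by
      ext x
      simp only [hS, Set.mem_preimage, Set.mem_ofPred_eq, Pi.add_apply, Set.mem_Ioc]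
      refine forall_congr' fun i => ?_
      constructor <;> rintro ⟨h1, h2⟩ <;> constructor <;> linarith
    rw [hpre]
    refine integral_congr_ae (ae_of_all _ fun y => ?_)
    simp only [Pi.add_apply, smul_eq_mul, hexp, mul_assoc]
  have hjc : Continuous fun p : ℝ × (Fin d → ℝ) =>
      UnitAddTorus.mFourier (-k) (fun i => (p.2 i : UnitAddCircle)) *
        (Complex.exp (-(2 * Real.pi * Complex.I * n) * p.1) *
          g (fun i => ((p.2 i + p.1 * v i : ℝ) : UnitAddCircle))) := by
    have hq : Continuous fun x : ℝ => (x : UnitAddCircle) := AddCircle.continuous_mk' 1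
    refine ((UnitAddTorus.mFourier (-k)).continuous.comp ?_).mul
      ((by fun_prop : Continuous _).mul (hg.comp ?_))
    · exact continuous_pi fun i => hq.comp (by fun_prop)
    · exact continuous_pi fun i => hq.comp (by fun_prop)
  have hswap : UnitAddTorus.mFourierCoeff g k =
      ∫ y in S, UnitAddTorus.mFourier (-k) (fun i => (y i : UnitAddCircle)) *
        ∫ t in (0 : ℝ)..1, Complex.exp (-(2 * Real.pi * Complex.I * n) * t) *
          g (fun i => ((y i + t * v i : ℝ) : UnitAddCircle)) := by
    have h1 : UnitAddTorus.mFourierCoeff g k =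
        ∫ t in (0 : ℝ)..1, UnitAddTorus.mFourierCoeff g k := by simp
    rw [h1]
    simp_rw [← intervalIntegral.integral_const_mul]
    rw [← intervalIntegral_integral_swap]
    · exact intervalIntegral.integral_congr fun t _ => hshift t
    · rw [Set.uIoc_of_le zero_le_one, Measure.prod_restrict]
      have hK : IsCompact (Set.Icc (0 : ℝ) 1 ×ˢ (Set.univ.pi fun _ : Fin d => Set.Icc (0 : ℝ) 1)) :=
        isCompact_Icc.prod (isCompact_univ_pi fun _ => isCompact_Icc)
      refine IntegrableOn.mono_set (hjc.continuousOn.integrableOn_compact hK) ?_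
      refine Set.prod_mono Set.Ioc_subset_Icc_self fun x hx i _ => ?_
      have := hx i
      rw [zero_add] at this
      exact Set.Ioc_subset_Icc_self this
  rw [hswap]
  refine (norm_setIntegral_le_of_norm_le_const (C := B * Real.exp (-(a * n))) (by simp [hSv])
    fun y hy => ?_).trans (by simp [measureReal_def, hSv])
  rw [norm_mul]
  have h1 : ‖UnitAddTorus.mFourier (-k) (fun i => (y i : UnitAddCircle))‖ ≤ 1 :=
    ((UnitAddTorus.mFourier (-k)).norm_coe_le_norm _).trans UnitAddTorus.mFourier_norm.le
  have h2 := hb y (fun i => by simpa using hy i) v hv n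
  calc _ ≤ 1 * ‖_‖ := mul_le_mul_of_nonneg_right h1 (norm_nonneg _)
    _ ≤ _ := by rw [one_mul]; exact h2

/-- The exponential of the `ℓ¹` norm factors over the coordinates, so on a finite box the sum is a
product of partial sums of one two-sided geometric series. -/
theorem summable_exp_neg_mul_sum_natAbs (d : ℕ) {a : ℝ} (ha : 0 < a) :
    Summable fun k : Fin d → ℤ => Real.exp (-(a * (∑ i, (k i).natAbs : ℕ))) := by
  have h1 : Summable fun j : ℤ => Real.exp (-(a * j.natAbs)) := by
    have h2 : Summable fun n : ℕ => Real.exp (-(a * n)) := by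
      have := summable_geometric_of_lt_one (Real.exp_pos (-a)).le (Real.exp_lt_one_iff.2 (by linarith))
      refine this.congr fun n => ?_
      rw [← Real.exp_nat_mul]; congr 1; ring
    exact Summable.of_nat_of_neg (by simpa using h2) (by simpa using h2)
  refine summable_of_sum_le (c := (∑' j : ℤ, Real.exp (-(a * j.natAbs))) ^ d)
    (fun k => (Real.exp_pos _).le) fun u => ?_
  classical
  calc ∑ k ∈ u, Real.exp (-(a * (∑ i, (k i).natAbs : ℕ)))
      ≤ ∑ k ∈ Fintype.piFinset fun i => u.image fun k => k i,
          Real.exp (-(a * (∑ i, (k i).natAbs : ℕ))) :=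
        Finset.sum_le_sum_of_subset_of_nonneg
          (fun k hk => Fintype.mem_piFinset.2 fun i => Finset.mem_image_of_mem _ hk)
          fun _ _ _ => (Real.exp_pos _).le
    _ = ∏ i, ∑ j ∈ u.image fun k => k i, Real.exp (-(a * j.natAbs)) := by
        rw [Finset.prod_univ_sum]
        refine Finset.sum_congr rfl fun k _ => ?_
        rw [← Real.exp_sum]
        congr 1
        push_cast
        rw [Finset.mul_sum, Finset.sum_neg_distrib]
    _ ≤ ∏ _i : Fin d, ∑' j : ℤ, Real.exp (-(a * j.natAbs)) :=
        Finset.prod_le_prod (fun _ _ => Finset.sum_nonneg fun _ _ => (Real.exp_pos _).le)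
          fun i _ => h1.sum_le_tsum _ fun _ _ => (Real.exp_pos _).le
    _ = _ := by simp

/-- The Fourier series of a function that is even in every variable is a multivariate cosine series. -/
theorem hasSum_mFourierCoeff_mul_prod_cos {d : ℕ} {g : C(UnitAddTorus (Fin d), ℂ)}
    (hs : Summable (UnitAddTorus.mFourierCoeff g))
    (heven : ∀ (x : UnitAddTorus (Fin d)) (σ : Fin d → Bool),
      g (fun i => if σ i then x i else -x i) = g x) (θ : Fin d → ℝ) :
    HasSum (fun k : Fin d → ℤ => UnitAddTorus.mFourierCoeff g k *
      ((∏ i, Real.cos (k i * (2 * Real.pi * θ i)) : ℝ) : ℂ))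
      (g (fun i => (θ i : UnitAddCircle))) := by
  set x : UnitAddTorus (Fin d) := fun i => (θ i : UnitAddCircle) with hx
  -- The series is averaged over all `2 ^ d` sign changes of the variables: evenness fixes the sum,
  -- while each character becomes a product of cosines.
  have h1 (σ : Fin d → Bool) := UnitAddTorus.hasSum_mFourier_series_apply_of_summable hs
    (fun i => if σ i then x i else -x i)
  have h2 := hasSum_sum (s := Finset.univ) fun σ (_ : σ ∈ (Finset.univ : Finset (Fin d → Bool))) =>
    h1 σ
  simp only [heven, Finset.sum_const, Finset.card_univ, Fintype.card_fun, Fintype.card_bool,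
    Fintype.card_fin, nsmul_eq_mul, smul_eq_mul, ← Finset.mul_sum] at h2
  have h3 := h2.mul_left (((2 : ℂ) ^ d)⁻¹)
  push_cast at h3
  rw [inv_mul_cancel_left₀ (pow_ne_zero _ two_ne_zero)] at h3
  refine h3.congr_fun fun k => ?_
  have h4 : ∑ σ : Fin d → Bool,
      UnitAddTorus.mFourier k (fun i => if σ i then x i else -x i) =
      ∏ i, (2 * Complex.cos (k i * (2 * Real.pi * θ i))) := by
    have := Finset.prod_univ_sum (fun _ : Fin d => (Finset.univ : Finset Bool))
      (fun i (b : Bool) => (fourier (k i) (if b then x i else -x i) : ℂ))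
    simp only [Fintype.piFinset_univ] at this
    simp only [UnitAddTorus.mFourier, ContinuousMap.coe_mk]
    rw [← this]
    refine Finset.prod_congr rfl fun i _ => ?_
    rw [Complex.two_cos]
    simp only [Fintype.sum_bool, hx, if_true, Bool.false_eq_true, if_false]
    rw [← AddCircle.coe_neg, fourier_coe_apply, fourier_coe_apply]
    congr 2 <;> push_cast <;> ring
  rw [h4, Finset.prod_mul_distrib]
  push_cast
  rw [Finset.prod_const, Finset.card_univ, Fintype.card_fin, mul_left_comm (UnitAddTorus.mFourierCoeff g k),
    inv_mul_cancel_left₀ (pow_ne_zero _ two_ne_zero)]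

/-! ### Cosine chart and Chebyshev polynomials -/

/-- The cosine parametrization `θ ↦ ((1 + cos 2πθ_j) / 2)_j` of the unit cube. -/
noncomputable def cosChart {d : ℕ} (θ : Fin d → ℝ) : Fin d → ℝ :=
  fun j => (1 + Real.cos (2 * Real.pi * θ j)) / 2

theorem cosChart_mem_unitCube {d : ℕ} (θ : Fin d → ℝ) : cosChart θ ∈ unitCube d := by
  refine ⟨fun j => ?_, fun j => ?_⟩
  · have := Real.neg_one_le_cos (2 * Real.pi * θ j)
    simp only [cosChart, Pi.zero_apply]; linarith
  · have := Real.cos_le_one (2 * Real.pi * θ j)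
    simp only [cosChart, Pi.one_apply]; linarith

theorem exists_cosChart_eq {d : ℕ} {x : Fin d → ℝ} (hx : x ∈ unitCube d) :
    ∃ θ, cosChart θ = x := by
  refine ⟨fun j => Real.arccos (2 * x j - 1) / (2 * Real.pi), ?_⟩
  ext j
  have h0 : 0 ≤ x j := hx.1 j
  have h1 : x j ≤ 1 := hx.2 j
  have hp := Real.pi_pos
  rw [cosChart, mul_div_cancel₀ _ (by positivity),
    Real.cos_arccos (by linarith) (by linarith)]
  ring

/-- The function `(1 + cos 2πx) / 2` on the circle `ℝ / ℤ`. -/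
noncomputable def circleCos (x : UnitAddCircle) : ℝ := (1 + (fourier 1 x : ℂ).re) / 2

theorem continuous_circleCos : Continuous circleCos := by
  unfold circleCos; fun_prop

theorem circleCos_coe (t : ℝ) : circleCos (t : UnitAddCircle) =
    (1 + Real.cos (2 * Real.pi * t)) / 2 := by
  rw [circleCos, fourier_coe_apply, Complex.exp_re]
  simp

theorem circleCos_neg (x : UnitAddCircle) : circleCos (-x) = circleCos x := by
  induction x using QuotientAddGroup.induction_on with
  | H t =>
    have h : (-(t : UnitAddCircle)) = ((-t : ℝ) : UnitAddCircle) := rfl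
    change circleCos (-(t : UnitAddCircle)) = circleCos (t : UnitAddCircle)
    rw [h, circleCos_coe, circleCos_coe, mul_neg, Real.cos_neg]

theorem MvPolynomial.totalDegree_polynomial_aeval_le {R σ : Type*} [CommSemiring R]
    (q : Polynomial R) {P : MvPolynomial σ R} (hP : P.totalDegree ≤ 1) :
    (Polynomial.aeval P q).totalDegree ≤ q.natDegree := by
  rw [Polynomial.aeval_eq_sum_range]
  refine MvPolynomial.totalDegree_finsetSum_le fun i hi => ?_
  refine (MvPolynomial.totalDegree_smul_le _ _).trans ((MvPolynomial.totalDegree_pow _ _).trans ?_)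
  calc i * P.totalDegree ≤ i * 1 := Nat.mul_le_mul_left _ hP
    _ ≤ _ := by rw [mul_one]; exact Nat.lt_succ_iff.1 (Finset.mem_range.1 hi)

/-- The product of shifted Chebyshev polynomials `∏ j, T_{k j} (2 x_j - 1)`. -/
noncomputable def mvChebyshev {d : ℕ} (k : Fin d → ℤ) : MvPolynomial (Fin d) ℝ :=
  ∏ j, Polynomial.aeval (MvPolynomial.C 2 * MvPolynomial.X j - MvPolynomial.C 1)
    (Polynomial.Chebyshev.T ℝ (k j))

/-- Total degree is controlled by the `ℓ¹` norm of the index, the same norm that governs the decay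
of the Fourier coefficients. -/
theorem totalDegree_mvChebyshev_le {d : ℕ} (k : Fin d → ℤ) :
    (mvChebyshev k).totalDegree ≤ ∑ j, (k j).natAbs := by
  refine (MvPolynomial.totalDegree_finsetProd _ _).trans (Finset.sum_le_sum fun j _ => ?_)
  rw [← Polynomial.Chebyshev.natDegree_T ℝ (k j)]
  refine MvPolynomial.totalDegree_polynomial_aeval_le _ ?_
  refine (MvPolynomial.totalDegree_sub_C_le _ _).trans ((MvPolynomial.totalDegree_mul _ _).trans ?_)
  simp

/-- The affine map `2 x - 1` undoes the rescaling in the chart, and `T_k (cos φ) = cos (k φ)`; this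
turns the cosine series into a polynomial series. -/
theorem eval_mvChebyshev_cosChart {d : ℕ} (k : Fin d → ℤ) (θ : Fin d → ℝ) :
    MvPolynomial.eval (cosChart θ) (mvChebyshev k) =
      ∏ j, Real.cos (k j * (2 * Real.pi * θ j)) := by
  rw [mvChebyshev, map_prod]
  refine Finset.prod_congr rfl fun j _ => ?_
  rw [← Polynomial.Chebyshev.T_real_cos, ← MvPolynomial.coe_aeval_eq_eval]
  change (MvPolynomial.aeval (cosChart θ)) (Polynomial.aeval _ _) = _
  rw [← Polynomial.aeval_algHom_apply, Polynomial.coe_aeval_eq_eval]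
  congr 1
  simp [cosChart]
  ring

/-! ### Polynomial approximation in the total degree -/

/-- If the Fourier coefficients of `f ∘ cosChart` along signed diagonals decay exponentially, then `f` has
exponentially good polynomial approximations with respect to the total degree. -/
theorem exists_polynomial_approximation {d : ℕ} {f : (Fin d → ℝ) → ℝ}
    (hf : ContinuousOn f (unitCube d)) {a B : ℝ} (ha : 0 < a)
    (hb : ∀ y : Fin d → ℝ, (∀ i, y i ∈ Set.Ioc (0 : ℝ) 1) → ∀ v : Fin d → ℝ,
      (∀ i, v i = 1 ∨ v i = -1) → ∀ n : ℕ,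
        ‖∫ t in (0 : ℝ)..1, Complex.exp (-(2 * Real.pi * Complex.I * n) * t) *
          (f (cosChart (y + t • v)) : ℂ)‖ ≤ B * Real.exp (-(a * n))) :
    ∃ K : ℝ, 0 ≤ K ∧ ∀ m : ℕ, ∃ p : MvPolynomial (Fin d) ℝ, p.totalDegree ≤ m ∧
      ∀ x ∈ unitCube d, |f x - MvPolynomial.eval x p| ≤ K * Real.exp (-(a / 2 * m)) := by
  have hcube (x : UnitAddTorus (Fin d)) : (fun j => circleCos (x j)) ∈ unitCube d := by
    have (j : Fin d) : ∃ t : ℝ, (t : UnitAddCircle) = x j := QuotientAddGroup.mk_surjective (x j)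
    choose θ hθ using this
    convert cosChart_mem_unitCube θ using 1
    ext j
    rw [← hθ, circleCos_coe, cosChart]
  let g : C(UnitAddTorus (Fin d), ℂ) :=
    ⟨fun x => (f (fun j => circleCos (x j)) : ℂ), Complex.continuous_ofReal.comp
      (hf.comp_continuous (continuous_pi fun j => continuous_circleCos.comp (continuous_apply j))
        hcube)⟩
  have hg (θ : Fin d → ℝ) : g (fun i => (θ i : UnitAddCircle)) = (f (cosChart θ) : ℂ) := by
    simp only [g, ContinuousMap.coe_mk, circleCos_coe]
    rfl
  set A : (Fin d → ℤ) → ℂ := UnitAddTorus.mFourierCoeff g with hA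
  have hAB (k) : ‖A k‖ ≤ B * Real.exp (-(a * (∑ i, (k i).natAbs : ℕ))) := by
    refine norm_mFourierCoeff_le g.continuous (fun y hy v hv n => ?_) k
    have h := hb y hy v hv n
    simp_rw [← hg] at h
    exact h
  have hB : 0 ≤ B := by
    have := (norm_nonneg _).trans (hAB 0)
    simpa using this
  have hS := summable_exp_neg_mul_sum_natAbs d ha
  have hsum : Summable fun k => ‖A k‖ :=
    Summable.of_nonneg_of_le (fun _ => norm_nonneg _) hAB (hS.mul_left B)
  -- The rate `a` is split in two: one half keeps the tail summable, the other half yields the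
  -- factor `exp (-(a / 2) m)` outside the truncation.
  have hS2 := summable_exp_neg_mul_sum_natAbs d (half_pos ha)
  set E : (Fin d → ℤ) → ℝ := fun k => Real.exp (-(a / 2 * (∑ i, (k i).natAbs : ℕ))) with hE
  have hseries (θ : Fin d → ℝ) : HasSum (fun k : Fin d → ℤ =>
      (A k).re * MvPolynomial.eval (cosChart θ) (mvChebyshev k)) (f (cosChart θ)) := by
    have h := hasSum_mFourierCoeff_mul_prod_cos (g := g) hsum.of_norm (fun x σ => by
      simp only [g, ContinuousMap.coe_mk]
      congr 2
      ext i
      split_ifs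
      · rfl
      · exact circleCos_neg _) θ
    rw [hg] at h
    have h2 := Complex.reCLM.hasSum h
    simpa [Function.comp_def, eval_mvChebyshev_cosChart, ← Complex.ofReal_prod] using! h2
  refine ⟨B * ∑' k, E k, mul_nonneg hB (tsum_nonneg fun _ => (Real.exp_pos _).le), fun m => ?_⟩
  let s : Finset (Fin d → ℤ) :=
    (Fintype.piFinset fun _ => Finset.Icc (-(m : ℤ)) m).filter fun k => ∑ i, (k i).natAbs ≤ m
  have hs (k : Fin d → ℤ) : k ∈ s ↔ ∑ i, (k i).natAbs ≤ m := by
    simp only [s, Finset.mem_filter, Fintype.mem_piFinset, Finset.mem_Icc, and_iff_right_iff_imp]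
    intro h i
    have := (Finset.single_le_sum (f := fun i => (k i).natAbs) (fun _ _ => Nat.zero_le _)
      (Finset.mem_univ i)).trans h
    omega
  refine ⟨∑ k ∈ s, (A k).re • mvChebyshev k, ?_, fun x hx => ?_⟩
  · exact MvPolynomial.totalDegree_finsetSum_le fun k hk =>
      (MvPolynomial.totalDegree_smul_le _ _).trans
        ((totalDegree_mvChebyshev_le k).trans ((hs k).1 hk))
  obtain ⟨θ, rfl⟩ := exists_cosChart_eq hx
  set u : (Fin d → ℤ) → ℝ := fun k => (A k).re * MvPolynomial.eval (cosChart θ) (mvChebyshev k)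
    with hu
  have heval : MvPolynomial.eval (cosChart θ) (∑ k ∈ s, (A k).re • mvChebyshev k) =
      ∑ k ∈ s, if k ∈ s then u k else 0 := by
    rw [map_sum]
    refine Finset.sum_congr rfl fun k hk => ?_
    rw [if_pos hk, MvPolynomial.smul_eval]
  have hfin : HasSum (fun k => if k ∈ s then u k else 0) (∑ k ∈ s, if k ∈ s then u k else 0) :=
    hasSum_sum_of_ne_finset_zero fun k hk => if_neg hk
  have hbound := ((hS2.hasSum.mul_left B).mul_right (Real.exp (-(a / 2 * m))))
  rw [heval, ← Real.norm_eq_abs, ← ((hseries θ).sub hfin).tsum_eq]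
  refine tsum_of_norm_bounded hbound fun k => ?_
  have hE0 : 0 ≤ B * E k * Real.exp (-(a / 2 * m)) :=
    mul_nonneg (mul_nonneg hB (Real.exp_pos _).le) (Real.exp_pos _).le
  by_cases hk : k ∈ s
  · simpa [hk, hu] using hE0
  · have hcos : |MvPolynomial.eval (cosChart θ) (mvChebyshev k)| ≤ 1 := by
      rw [eval_mvChebyshev_cosChart, Finset.abs_prod]
      exact Finset.prod_le_one (fun _ _ => abs_nonneg _) fun _ _ => Real.abs_cos_le_one _
    have hm : (m : ℝ) ≤ (∑ i, (k i).natAbs : ℕ) := by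
      have := mt (hs k).2 hk
      exact_mod_cast (not_le.1 this).le
    rw [if_neg hk, sub_zero, norm_mul, Real.norm_eq_abs, Real.norm_eq_abs]
    calc |(A k).re| * |MvPolynomial.eval (cosChart θ) (mvChebyshev k)|
        ≤ ‖A k‖ * 1 := mul_le_mul (Complex.abs_re_le_norm _) hcos (abs_nonneg _) (norm_nonneg _)
      _ ≤ B * Real.exp (-(a * (∑ i, (k i).natAbs : ℕ))) := by rw [mul_one]; exact hAB k
      _ ≤ B * (E k * Real.exp (-(a / 2 * m))) := by
          rw [hE, ← Real.exp_add]
          gcongr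
          nlinarith
      _ = _ := by ring


/-! ### Holomorphic functions on Bernstein ellipses -/

/-- By the half-angle formulas the two norms are `|cos (w / 2)|²` and `|sin (w / 2)|²`. Consequently
the strip `|Im w| < log ρ` is mapped into the Bernstein ellipse of radius `ρ`. -/
theorem Complex.norm_one_add_cos_div_two_add (w : ℂ) :
    ‖(1 + Complex.cos w) / 2‖ + ‖(1 + Complex.cos w) / 2 - 1‖ = Real.cosh w.im := by
  have h1 : (1 + Complex.cos w) / 2 = Complex.cos (w / 2) ^ 2 := by
    rw [Complex.cos_sq, mul_div_cancel₀ _ two_ne_zero]; ring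
  have h2 : Complex.cos (w / 2) ^ 2 - 1 = -Complex.sin (w / 2) ^ 2 := by
    rw [Complex.sin_sq]; ring
  have hw : w / 2 = ((w.re / 2 : ℝ) : ℂ) + ((w.im / 2 : ℝ) : ℂ) * Complex.I := by
    apply Complex.ext <;> simp
  have hc : w.im = 2 * (w.im / 2) := by ring
  rw [h1, h2, norm_neg, norm_pow, norm_pow, hc, Real.cosh_two_mul, ← Complex.normSq_eq_norm_sq,
    ← Complex.normSq_eq_norm_sq, hw]
  generalize w.re / 2 = p
  generalize w.im / 2 = q
  rw [Complex.cos_add_mul_I, Complex.sin_add_mul_I]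
  simp only [← Complex.ofReal_cos, ← Complex.ofReal_sin, ← Complex.ofReal_cosh,
    ← Complex.ofReal_sinh, Complex.normSq_apply]
  simp [Complex.cos_ofReal_re, Complex.sin_ofReal_re, Complex.sinh_ofReal_re,
    Complex.cosh_ofReal_re]
  have e1 := Real.sin_sq_add_cos_sq p
  have e2 := Real.cosh_sq q
  linear_combination (Real.cosh q ^ 2 + Real.sinh q ^ 2) * e1

/-- Exponential decay of the diagonal Fourier coefficients of a function that is holomorphic on a product of Bernstein
ellipses, with a rate that depends only on the radius. -/
theorem HasBernsteinExtension.exists_norm_integral_le {d : ℕ} {f : (Fin d → ℝ) → ℝ} {ρ : ℝ}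
    (hρ : 1 < ρ) (hf : HasBernsteinExtension f ρ) :
    ContinuousOn f (unitCube d) ∧
    ∃ B : ℝ, ∀ y v : Fin d → ℝ, (∀ i, v i = 1 ∨ v i = -1) → ∀ n : ℕ,
        ‖∫ t in (0 : ℝ)..1, Complex.exp (-(2 * Real.pi * Complex.I * n) * t) *
          (f (cosChart (y + t • v)) : ℂ)‖ ≤ B * Real.exp (-(Real.log ρ / 4 * n)) := by
  obtain ⟨F, hF, hFf⟩ := hf
  have hlog : 0 < Real.log ρ := Real.log_pos hρ
  have hcosh : Real.cosh (Real.log ρ) = (ρ + ρ⁻¹) / 2 := Real.cosh_log (by linarith)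
  have hpi := Real.pi_pos
  have hmem (w : ℂ) (hw : |w.im| < Real.log ρ) :
      (1 + Complex.cos w) / 2 ∈ bernsteinEllipse ρ := by
    rw [bernsteinEllipse, Set.mem_ofPred_eq, Complex.norm_one_add_cos_div_two_add, ← hcosh, Real.cosh_lt_cosh, abs_of_pos hlog]
    exact hw
  have hEo : IsOpen (bernsteinEllipse ρ) :=
    isOpen_lt (by fun_prop) continuous_const
  have hDo : IsOpen {z : Fin d → ℂ | ∀ j, z j ∈ bernsteinEllipse ρ} := by
    simp only [Set.ofPred_forall]
    exact isOpen_iInter_of_finite fun j => hEo.preimage (continuous_apply j)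
  have hreal (θ : Fin d → ℝ) : (fun j => (1 + Complex.cos (2 * Real.pi * θ j)) / 2) =
      fun j => ((cosChart θ j : ℝ) : ℂ) := by
    ext j; simp [cosChart]
  have hcube : ∀ x ∈ unitCube d, (fun j => (x j : ℂ)) ∈ {z : Fin d → ℂ | ∀ j, z j ∈ bernsteinEllipse ρ} := by
    intro x hx j
    obtain ⟨θ, rfl⟩ := exists_cosChart_eq hx
    have hj := hmem (2 * Real.pi * θ j)
    rw [congrFun (hreal θ) j] at hj
    refine hj ?_
    rw [← Complex.ofReal_ofNat, ← Complex.ofReal_mul, ← Complex.ofReal_mul, Complex.ofReal_im, abs_zero]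
    exact hlog
  constructor
  · have h1 : ContinuousOn (fun x : Fin d → ℝ => (F (fun j => (x j : ℂ))).re) (unitCube d) :=
      Complex.continuous_re.comp_continuousOn (hF.continuousOn.comp (by fun_prop) hcube)
    exact h1.congr fun x hx => by simp only [hFf x hx, Complex.ofReal_re]
  -- `F` need not be bounded on the open product, so the bound is taken on the compact product of
  -- closed ellipses with parameter `log ρ / 2`.
  obtain ⟨M, hM⟩ : ∃ M, ∀ z : Fin d → ℂ,
      (∀ j, z j ∈ {z : ℂ | ‖z‖ + ‖z - 1‖ ≤ Real.cosh (Real.log ρ / 2)}) → ‖F z‖ ≤ M := by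
    have hK : IsCompact {z : ℂ | ‖z‖ + ‖z - 1‖ ≤ Real.cosh (Real.log ρ / 2)} := by
      refine Metric.isCompact_of_isClosed_isBounded (isClosed_le (by fun_prop) continuous_const) ?_
      refine (Metric.isBounded_closedBall (x := (0 : ℂ)) (r := Real.cosh (Real.log ρ / 2))).subset
        fun z hz => ?_
      rw [mem_closedBall_zero_iff]
      exact (le_add_of_nonneg_right (norm_nonneg _)).trans hz
    have hKpi := isCompact_univ_pi fun _ : Fin d => hK
    have hlt : Real.cosh (Real.log ρ / 2) < (ρ + ρ⁻¹) / 2 := by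
      rw [← hcosh, Real.cosh_lt_cosh, abs_of_pos hlog, abs_of_pos (half_pos hlog)]
      linarith
    obtain ⟨M, hM⟩ := hKpi.exists_bound_of_continuousOn
      (hF.continuousOn.mono fun z hz j => lt_of_le_of_lt (hz j trivial) hlt)
    exact ⟨M, fun z hz => hM z fun j _ => hz j⟩
  refine ⟨2 * M, fun y v hv n => ?_⟩
  -- With this radius `|Im ζ| ≤ r` means an imaginary part of at most `log ρ / 2` in each cosine
  -- argument, where `M` applies, while `H` is holomorphic for `|Im ζ| < 2 r`. The decay rate is `π
  -- r = log ρ / 4`.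
  set r : ℝ := Real.log ρ / (4 * Real.pi) with hr
  have hr0 : 0 < r := by positivity
  set H : ℂ → ℂ := fun ζ => F fun j => (1 + Complex.cos (2 * Real.pi * (y j + ζ * v j))) / 2 with hH
  have him (ζ : ℂ) (j : Fin d) :
      |(2 * Real.pi * (y j + ζ * v j) : ℂ).im| = 2 * Real.pi * |ζ.im| := by
    have : (2 * Real.pi * (y j + ζ * v j) : ℂ).im = 2 * Real.pi * (ζ.im * v j) := by
      simp
    rw [this, abs_mul, abs_of_pos (by positivity : (0 : ℝ) < 2 * Real.pi)]
    rcases hv j with h | h <;> simp [h]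
  have hdiff (ζ : ℂ) (hζ : |ζ.im| < 2 * r) : DifferentiableAt ℂ H ζ := by
    refine DifferentiableAt.comp ζ (g := F) (hF.differentiableAt (hDo.mem_nhds fun j => ?_)) (by fun_prop)
    refine hmem _ ?_
    rw [him]
    calc 2 * Real.pi * |ζ.im| < 2 * Real.pi * (2 * r) := by gcongr
      _ = Real.log ρ := by rw [hr]; field_simp; ring
  have hUo : IsOpen {ζ : ℂ | |ζ.im| < 2 * r} := isOpen_lt (by fun_prop) continuous_const
  have hper (ζ : ℂ) : H (ζ + 1) = H ζ := by
    simp only [hH]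
    congr 1
    ext j
    congr 2
    rcases hv j with h | h
    · rw [h, ← Complex.cos_add_two_pi (2 * Real.pi * (y j + ζ * (1 : ℝ)))]
      congr 1; push_cast; ring
    · rw [h, ← Complex.cos_sub_two_pi (2 * Real.pi * (y j + ζ * (-1 : ℝ)))]
      congr 1; push_cast; ring
  have han (t : ℝ) : AnalyticAt ℂ H t := by
    refine DifferentiableOn.analyticAt (s := {ζ : ℂ | |ζ.im| < 2 * r})
      (fun ζ hζ => (hdiff ζ hζ).differentiableWithinAt) (hUo.mem_nhds ?_)
    simp [hr0]
  have key := norm_integral_exp_mul_le (h := fun l t => iteratedDeriv l H t) (B := M) (R := r⁻¹)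
    (fun l t => ?_) (fun l => ?_) (by positivity) (fun l t ht => ?_) n
  · have hint : ∀ t : ℝ, iteratedDeriv 0 H t = (f (cosChart (y + t • v)) : ℂ) := fun t => by
      rw [iteratedDeriv_zero, ← hFf _ (cosChart_mem_unitCube _), ← hreal]
      simp [hH]
    simp only [hint] at key
    refine key.trans (le_of_eq ?_)
    rw [hr]
    congr 3
    field_simp
  · have h1 : DifferentiableAt ℂ (iteratedDeriv l H) t := by
      rw [iteratedDeriv_eq_iterate]
      exact ((han t).iterated_deriv l).differentiableAt
    have h2 := h1.hasDerivAt.comp_ofReal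
    rwa [← iteratedDeriv_succ] at h2
  · have := congrFun (iteratedDeriv_comp_add_const l H 1) 0
    simp only [hper] at this
    simpa using this.symm
  · have hball (ζ : ℂ) (hζ : ζ ∈ Metric.closedBall (t : ℂ) r) : |ζ.im| ≤ r := by
      have h1 := (Complex.abs_im_le_norm (ζ - t)).trans (mem_closedBall_iff_norm.1 hζ)
      simpa using h1
    have h1 := Complex.norm_iteratedDeriv_le_of_forall_mem_sphere_norm_le (c := (t : ℂ)) (R := r)
      (C := M) (f := H) l hr0 ?_ ?_
    · refine h1.trans (le_of_eq ?_)
      rw [inv_pow]; ring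
    · refine DifferentiableOn.diffContOnCl_ball (U := {ζ : ℂ | |ζ.im| < 2 * r})
        (fun ζ hζ => (hdiff ζ hζ).differentiableWithinAt) fun ζ hζ => ?_
      exact (hball ζ hζ).trans_lt (by linarith)
    · intro ζ hζ
      refine hM _ fun j => ?_
      rw [Set.mem_ofPred_eq, Complex.norm_one_add_cos_div_two_add, Real.cosh_le_cosh, him, abs_of_pos (half_pos hlog)]
      calc 2 * Real.pi * |ζ.im| ≤ 2 * Real.pi * r := by
            gcongr; exact hball ζ (Metric.sphere_subset_closedBall hζ)
        _ = Real.log ρ / 2 := by rw [hr]; field_simp; ring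


/-! ### Real analytic functions near the cube -/

/-- Cauchy type estimates for the derivatives of a real analytic function, near a point. -/
theorem AnalyticAt.eventually_norm_iteratedFDeriv_le {E F : Type*} [NormedAddCommGroup E]
    [NormedSpace ℝ E] [NormedAddCommGroup F] [NormedSpace ℝ F] [CompleteSpace F] {G : E → F}
    {x₀ : E} (hG : AnalyticAt ℝ G x₀) :
    ∃ B R : ℝ, ∀ᶠ x in nhds x₀, ∀ (l : ℕ) (v : E), ‖v‖ ≤ 1 →
      ‖iteratedFDeriv ℝ l G x fun _ => v‖ ≤ B * l.factorial * R ^ l := by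
  obtain ⟨p, r, hp⟩ := hG
  obtain ⟨s, hs0, hsr⟩ : ∃ s : NNReal, 0 < s ∧ ((s + s : NNReal) : ENNReal) < r := by
    obtain ⟨q, hq0, hqr⟩ := ENNReal.lt_iff_exists_nnreal_btwn.1 hp.r_pos
    exact ⟨q / 2, half_pos (by exact_mod_cast hq0), by rwa [add_halves]⟩
  have hrad : ((s : ENNReal) + s) < p.radius := by
    rw [← ENNReal.coe_add]; exact hsr.trans_le hp.r_le
  have hsum := p.changeOriginSeries_summable_aux₁ hrad
  -- This sum over all re-expansion terms dominates every coefficient at `x₀ + y`, times `s ^ l`,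
  -- uniformly in `‖y‖ ≤ s`.
  set A : NNReal := ∑' t : Σ k l : ℕ, { u : Finset (Fin (k + l)) // u.card = l },
    ‖p (t.1 + t.2.1)‖₊ * s ^ t.2.1 * s ^ t.1 with hA
  refine ⟨A, (s : ℝ)⁻¹, ?_⟩
  filter_upwards [Metric.closedBall_mem_nhds x₀ (NNReal.coe_pos.2 hs0)] with x hx l v hv
  obtain ⟨y, rfl⟩ : ∃ y, x = x₀ + y := ⟨x - x₀, by abel⟩
  have hy : ‖y‖₊ ≤ s := by
    have : ‖y‖ ≤ s := by simpa using hx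
    exact_mod_cast this
  have hyr : (‖y‖₊ : ENNReal) < r :=
    lt_of_le_of_lt (by exact_mod_cast hy.trans (le_add_of_nonneg_right s.2)) hsr
  have hq := hp.changeOrigin hyr
  have hcoef : ‖p.changeOrigin y l‖₊ * s ^ l ≤ A := by
    have hk := (NNReal.summable_sigma.1 hsum).1 l
    have hyrad : (‖y‖₊ : ENNReal) < p.radius := hyr.trans_le hp.r_le
    have hsl : (0 : NNReal) < s ^ l := pow_pos hs0 l
    calc ‖p.changeOrigin y l‖₊ * s ^ l
        ≤ (∑' t : Σ j : ℕ, { u : Finset (Fin (l + j)) // u.card = j },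
            ‖p (l + t.1)‖₊ * ‖y‖₊ ^ t.1) * s ^ l := by
          gcongr; exact p.nnnorm_changeOrigin_le l hyrad
      _ = ∑' t : Σ j : ℕ, { u : Finset (Fin (l + j)) // u.card = j },
            ‖p (l + t.1)‖₊ * ‖y‖₊ ^ t.1 * s ^ l := NNReal.tsum_mul_right _ _ |>.symm
      _ ≤ ∑' t : Σ j : ℕ, { u : Finset (Fin (l + j)) // u.card = j },
            ‖p (l + t.1)‖₊ * s ^ t.1 * s ^ l := by
          have hle (t : Σ j : ℕ, { u : Finset (Fin (l + j)) // u.card = j }) :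
              ‖p (l + t.1)‖₊ * ‖y‖₊ ^ t.1 * s ^ l ≤ ‖p (l + t.1)‖₊ * s ^ t.1 * s ^ l := by gcongr
          exact (NNReal.summable_of_le hle hk).tsum_le_tsum hle hk
      _ ≤ A := by
          have h2 := NNReal.summable_sigma.1 hsum
          rw [hA, hsum.tsum_sigma' h2.1]
          exact h2.2.le_tsum l fun _ _ => zero_le
  -- The derivative is the coefficient summed over permutations of its arguments; these being all
  -- `v`, the sum is `l!` equal terms.
  rw [hq.iteratedFDeriv_eq_sum_of_completeSpace]
  rw [Finset.sum_const, Finset.card_univ, Fintype.card_perm, Fintype.card_fin, ← Nat.cast_smul_eq_nsmul ℝ,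
    norm_smul, Real.norm_natCast]
  have h1 : ‖p.changeOrigin y l fun _ => v‖ ≤ ‖p.changeOrigin y l‖ := by
    refine ((p.changeOrigin y l).le_opNorm _).trans (mul_le_of_le_one_right (norm_nonneg _) ?_)
    exact Finset.prod_le_one (fun _ _ => norm_nonneg _) fun _ _ => hv
  have h2 : ‖p.changeOrigin y l‖ * (s : ℝ) ^ l ≤ A := by exact_mod_cast hcoef
  have hs0' : (0 : ℝ) < s := hs0
  rw [inv_pow, mul_right_comm, mul_comm, ← div_eq_mul_inv]
  gcongr
  rw [le_div_iff₀ (by positivity)]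
  exact (mul_le_mul_of_nonneg_right h1 (by positivity)).trans h2

/-- Uniform Cauchy type estimates for the derivatives of a real analytic function on a compact set. -/
theorem IsCompact.exists_norm_iteratedFDeriv_le {E F : Type*} [NormedAddCommGroup E]
    [NormedSpace ℝ E] [NormedAddCommGroup F] [NormedSpace ℝ F] [CompleteSpace F] {G : E → F}
    {K : Set E} (hK : IsCompact K) (hG : AnalyticOnNhd ℝ G K) :
    ∃ B R : ℝ, 0 < B ∧ 0 < R ∧ ∀ x ∈ K, ∀ (l : ℕ) (v : E), ‖v‖ ≤ 1 →
      ‖iteratedFDeriv ℝ l G x fun _ => v‖ ≤ B * l.factorial * R ^ l := by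
  refine hK.induction_on (p := fun K => ∃ B R : ℝ, 0 < B ∧ 0 < R ∧ ∀ x ∈ K, ∀ (l : ℕ) (v : E), ‖v‖ ≤ 1 →
      ‖iteratedFDeriv ℝ l G x fun _ => v‖ ≤ B * l.factorial * R ^ l) ?_ ?_ ?_ ?_
  · exact ⟨1, 1, one_pos, one_pos, by simp⟩
  · rintro S T hST ⟨B, R, hB, hR, h⟩
    exact ⟨B, R, hB, hR, fun x hx => h x (hST hx)⟩
  · rintro S T ⟨B, R, hB, hR, h⟩ ⟨B', R', hB', hR', h'⟩
    refine ⟨max B B', max R R', lt_max_of_lt_left hB, lt_max_of_lt_left hR, fun x hx l v hv => ?_⟩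
    rcases hx with hx | hx
    · refine (h x hx l v hv).trans ?_
      gcongr <;> exact le_max_left _ _
    · refine (h' x hx l v hv).trans ?_
      gcongr <;> exact le_max_right _ _
  · intro x hx
    obtain ⟨B, R, h⟩ := (hG x hx).eventually_norm_iteratedFDeriv_le
    refine ⟨_, mem_nhdsWithin_of_mem_nhds h, |B| + 1, |R| + 1, by positivity, by positivity,
      fun z hz l v hv => (hz l v hv).trans ?_⟩
    refine (le_abs_self _).trans ?_
    rw [abs_mul, abs_mul, abs_pow, Nat.abs_cast]
    gcongr <;> linarith

/-- Exponential decay of the diagonal Fourier coefficients of a function that is real analytic near the unit cube. -/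
theorem AnalyticOnNhd.exists_norm_integral_le {d : ℕ} {f : (Fin d → ℝ) → ℝ}
    (hf : AnalyticOnNhd ℝ f (unitCube d)) :
    ∃ B a : ℝ, 0 < a ∧ ∀ y : Fin d → ℝ, (∀ i, y i ∈ Set.Ioc (0 : ℝ) 1) → ∀ v : Fin d → ℝ,
      (∀ i, v i = 1 ∨ v i = -1) → ∀ n : ℕ,
        ‖∫ t in (0 : ℝ)..1, Complex.exp (-(2 * Real.pi * Complex.I * n) * t) *
          (f (cosChart (y + t • v)) : ℂ)‖ ≤ B * Real.exp (-(a * n)) := by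
  set G : (Fin d → ℝ) → ℝ := fun θ => f (cosChart θ) with hGdef
  have hG (θ) : AnalyticAt ℝ G θ := by
    refine (hf _ (cosChart_mem_unitCube θ)).comp (f := cosChart) ?_
    refine analyticAt_pi_iff.2 fun j => ?_
    have h1 : AnalyticAt ℝ (fun θ : Fin d → ℝ => 2 * Real.pi * θ j) θ :=
      analyticAt_const.mul ((ContinuousLinearMap.proj (R := ℝ) j).analyticAt θ)
    exact (analyticAt_const.add (Real.analyticAt_cos.comp h1)).div analyticAt_const two_ne_zero
  -- Radius 2 covers every `y + t • v` with `‖y‖ ≤ 1`, `‖v‖ ≤ 1` and `t ∈ [0, 1]`.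
  obtain ⟨B, R, hB, hR, hBR⟩ := (isCompact_closedBall (0 : Fin d → ℝ) 2).exists_norm_iteratedFDeriv_le
    fun θ _ => hG θ
  refine ⟨2 * B, Real.pi / R, by positivity, fun y hy v hv n => ?_⟩
  have hv1 : ‖v‖ ≤ 1 := (pi_norm_le_iff_of_nonneg zero_le_one).2 fun i => by
    rcases hv i with h | h <;> simp [h]
  have hy1 : ‖y‖ ≤ 1 := (pi_norm_le_iff_of_nonneg zero_le_one).2 fun i => by
    rw [Real.norm_eq_abs, abs_of_pos (hy i).1]; exact (hy i).2
  have hper (θ) : G (θ + v) = G θ := by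
    simp only [hGdef]
    congr 1
    ext j
    simp only [cosChart, Pi.add_apply]
    congr 2
    rcases hv j with h | h
    · rw [h, ← Real.cos_add_two_pi (2 * Real.pi * θ j)]
      congr 1; ring
    · rw [h, ← Real.cos_sub_two_pi (2 * Real.pi * θ j)]
      congr 1; ring
  have key := norm_integral_exp_mul_le
    (h := fun l t => ((iteratedFDeriv ℝ l G (y + t • v) fun _ => v : ℝ) : ℂ)) (B := B) (R := R)
    (fun l t => ?_) (fun l => ?_) hR (fun l t ht => ?_) n
  · simpa only [iteratedFDeriv_zero_apply] using key
  · have hc : ContDiffAt ℝ (⊤ : ℕ∞) G (y + t • v) := (hG _).contDiffAt.of_le le_top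
    have h1 : DifferentiableAt ℝ (iteratedFDeriv ℝ l G) (y + t • v) :=
      hc.differentiableAt_iteratedFDeriv (by exact_mod_cast WithTop.coe_lt_top l)
    have hline : HasDerivAt (fun t : ℝ => y + t • v) v t := by
      simpa using ((hasDerivAt_id t).smul_const v).const_add y
    have h2 := h1.hasFDerivAt.comp_hasDerivAt t hline
    have h3 := ((ContinuousMultilinearMap.apply ℝ (fun _ : Fin l => Fin d → ℝ) ℝ
      (fun _ => v)).hasFDerivAt.comp_hasDerivAt t h2).ofReal_comp
    simpa [Function.comp_def, iteratedFDeriv_succ_apply_left, Fin.tail_def] using! h3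
  · have h1 : (fun θ => G (θ + v)) = G := funext hper
    have h2 := iteratedFDeriv_comp_add_right (𝕜 := ℝ) (f := G) l v y
    rw [h1] at h2
    simp [h2]
  · rw [Complex.norm_real]
    refine hBR _ ?_ l v hv1
    rw [mem_closedBall_zero_iff]
    calc ‖y + t • v‖ ≤ ‖y‖ + ‖t • v‖ := norm_add_le _ _
      _ ≤ 1 + 1 * 1 := by
        rw [norm_smul, Real.norm_eq_abs, abs_of_nonneg ht.1]
        gcongr
        exact ht.2
      _ = 2 := by norm_num

/-! ### Cubature error -/

/-- A positive cubature formula that integrates polynomials exactly integrates functions with good polynomial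
approximations accurately. -/
theorem CubatureFormula.abs_weightedIntegral_sub_apply_le {d N m : ℕ} {C : CubatureFormula d N}
    {ω f : (Fin d → ℝ) → ℝ} (hω : ∀ x ∈ unitCube d, 0 ≤ ω x) (hi : IntegrableOn ω (unitCube d))
    (hf : ContinuousOn f (unitCube d)) (hin : C.IsInside) (hpos : C.IsPositive)
    (hex : C.IsExact ω m) {p : MvPolynomial (Fin d) ℝ} (hp : p.totalDegree ≤ m) {ε : ℝ}
    (hε : ∀ x ∈ unitCube d, |f x - MvPolynomial.eval x p| ≤ ε) :
    |weightedIntegral ω f - C.apply f| ≤ 2 * (∫ x in unitCube d, ω x) * ε := by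
  have hm : MeasurableSet (unitCube d) := measurableSet_Icc
  have hK : IsCompact (unitCube d) := isCompact_Icc
  have hpc : Continuous fun x : Fin d → ℝ => MvPolynomial.eval x p := MvPolynomial.continuous_eval p
  have hint : |weightedIntegral ω f - weightedIntegral ω (fun x => MvPolynomial.eval x p)| ≤
      (∫ x in unitCube d, ω x) * ε := by
    rw [weightedIntegral, weightedIntegral, ← integral_sub
      (hi.continuousOn_mul hf hK) (hi.continuousOn_mul hpc.continuousOn hK), ← Real.norm_eq_abs,
      ← integral_mul_const]
    refine norm_integral_le_of_norm_le (hi.mul_const ε) ((ae_restrict_iff' hm).2 (ae_of_all _ fun x hx => ?_))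
    rw [← sub_mul, norm_mul, Real.norm_eq_abs, Real.norm_of_nonneg (hω x hx), mul_comm]
    exact mul_le_mul_of_nonneg_left (hε x hx) (hω x hx)
  -- Exactness on the constant 1; with positivity it bounds the sum of `|w_n|` independently of `N`.
  have hsum : ∑ n, C.weight n = ∫ x in unitCube d, ω x := by
    have := hex 1 (by simp)
    simpa [CubatureFormula.apply, weightedIntegral] using this
  have hcub : |C.apply (fun x => MvPolynomial.eval x p) - C.apply f| ≤
      (∫ x in unitCube d, ω x) * ε := by
    rw [CubatureFormula.apply, CubatureFormula.apply, ← Finset.sum_sub_distrib, ← hsum, Finset.sum_mul]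
    refine (Finset.abs_sum_le_sum_abs _ _).trans (Finset.sum_le_sum fun n _ => ?_)
    rw [← mul_sub, abs_mul, abs_of_pos (hpos n), abs_sub_comm]
    exact mul_le_mul_of_nonneg_left (hε _ (hin n)) (hpos n).le
  rw [← hex p hp] at hint
  calc _ ≤ _ := abs_sub_le _ (C.apply fun x => MvPolynomial.eval x p) _
    _ ≤ _ := by linarith

theorem CubatureFormula.isBigO_exp_of_polynomial_approximation {d : ℕ} (hd : 1 ≤ d)
    {f : (Fin d → ℝ) → ℝ} (hf : ContinuousOn f (unitCube d)) {K c : ℝ} (hc : 0 < c)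
    (hK : 0 ≤ K)
    (happrox : ∀ m : ℕ, ∃ p : MvPolynomial (Fin d) ℝ, p.totalDegree ≤ m ∧
      ∀ x ∈ unitCube d, |f x - MvPolynomial.eval x p| ≤ K * Real.exp (-(c * m)))
    {ω : (Fin d → ℝ) → ℝ} (hω : ∀ x ∈ unitCube d, 0 ≤ ω x) (hi : IntegrableOn ω (unitCube d))
    {m : ℕ → ℕ} {C : (N : ℕ) → CubatureFormula d N}
    (hC : ∀ᶠ N in atTop, (C N).IsInside ∧ (C N).IsPositive ∧ (C N).IsExact ω (m N)) :
    (fun N => |weightedIntegral ω f - (C N).apply f|) =O[atTop]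
      (fun N => Real.exp (-c * (m N : ℝ) / √(d : ℝ))) := by
  have hI : 0 ≤ ∫ x in unitCube d, ω x := setIntegral_nonneg measurableSet_Icc hω
  refine IsBigO.of_bound (2 * (∫ x in unitCube d, ω x) * K) ?_
  filter_upwards [hC] with N hN
  obtain ⟨p, hp, hpf⟩ := happrox (m N)
  rw [Real.norm_eq_abs, abs_abs, Real.norm_of_nonneg (Real.exp_pos _).le]
  refine (CubatureFormula.abs_weightedIntegral_sub_apply_le hω hi hf hN.1 hN.2.1 hN.2.2 hp hpf).trans ?_
  rw [← mul_assoc]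
  gcongr
  -- The bound `exp (-c m)` is already stronger; dividing by `√d ≥ 1` only weakens it.
  have h1 : 1 ≤ √(d : ℝ) := Real.one_le_sqrt.2 (by exact_mod_cast hd)
  rw [neg_mul, neg_div, neg_le_neg_iff]
  exact div_le_self (by positivity) h1

theorem lemma4p1 :
    -- every function analytic near the cube has an exponential rate
    (∀ (d : ℕ), 1 ≤ d → ∀ (U : Set (Fin d → ℝ)), IsOpen U → unitCube d ⊆ U →
      ∀ (f : (Fin d → ℝ) → ℝ), AnalyticOnNhd ℝ f U →
      ∃ c : ℝ, 0 < c ∧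
        ∀ (ω : (Fin d → ℝ) → ℝ), (∀ x ∈ unitCube d, 0 ≤ ω x) → IntegrableOn ω (unitCube d) →
        ∀ (m : ℕ → ℕ) (C : (N : ℕ) → CubatureFormula d N),
          (∀ᶠ N in atTop, (C N).IsInside ∧ (C N).IsPositive ∧ (C N).IsExact ω (m N)) →
          (fun N => |weightedIntegral ω f - (C N).apply f|) =O[atTop]
            (fun N => Real.exp (-c * (m N : ℝ) / √(d : ℝ)))) ∧
    -- the rate constant depends only on the radius of the ellipses of holomorphy, not on `d`
    (∀ (ρ : ℝ), 1 < ρ →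
      ∃ c : ℝ, 0 < c ∧
        ∀ (d : ℕ), 1 ≤ d → ∀ (f : (Fin d → ℝ) → ℝ), HasBernsteinExtension f ρ →
        ∀ (ω : (Fin d → ℝ) → ℝ), (∀ x ∈ unitCube d, 0 ≤ ω x) → IntegrableOn ω (unitCube d) →
        ∀ (m : ℕ → ℕ) (C : (N : ℕ) → CubatureFormula d N),
          (∀ᶠ N in atTop, (C N).IsInside ∧ (C N).IsPositive ∧ (C N).IsExact ω (m N)) →
          (fun N => |weightedIntegral ω f - (C N).apply f|) =O[atTop]
            (fun N => Real.exp (-c * (m N : ℝ) / √(d : ℝ)))) := by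
  refine ⟨fun d hd U _ hU f hf => ?_, fun ρ hρ => ?_⟩
  · obtain ⟨B, a, ha, hB⟩ := (hf.mono hU).exists_norm_integral_le
    have hcont := (hf.mono hU).continuousOn
    obtain ⟨K, hK, happrox⟩ := exists_polynomial_approximation hcont ha hB
    exact ⟨a / 2, half_pos ha, fun ω hω hi m C hC =>
      CubatureFormula.isBigO_exp_of_polynomial_approximation hd hcont (half_pos ha) hK happrox
        hω hi hC⟩
  · have ha : 0 < Real.log ρ / 4 := div_pos (Real.log_pos hρ) four_pos
    -- The rate is fixed before `d` and `f` are introduced; only the prefactor `K` depends on them.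
    refine ⟨Real.log ρ / 4 / 2, half_pos ha, fun d hd f hf ω hω hi m C hC => ?_⟩
    obtain ⟨hcont, B, hB⟩ := hf.exists_norm_integral_le hρ
    obtain ⟨K, hK, happrox⟩ := exists_polynomial_approximation hcont ha fun y _ => hB y
    exact CubatureFormula.isBigO_exp_of_polynomial_approximation hd hcont (half_pos ha) hK happrox
      hω hi hC
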